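/- **Theorem 3.1.** Let $\phi\in C_c^\infty(\mathbb{R}^2)$ with $\phi(\xi)=1$ for $|\xi|\le 1$, put $\psi(\xi)=\phi(\xi/2)-\phi(\xi)$, and for $j\in\mathbb{Z}$ let $P_j$ be the Littlewood--Paley projection $P_jf=\mathcal F^{-1}\big(\psi(2^{-j}\xi)\hat f(\xi)\big)$ on tempered distributions, where $\hat f(\xi)=\int_{\mathbb{R}^2}e^{-ix\cdot\xi}f(x)\,dx$ for integrable $f$. For $t\in\mathbb{R}$ let $e^{it\Delta}$ be the free Schrödinger propagator on $L^2(\mathbb{R}^2)$, that is, the Fourier multiplier with symbol $e^{-it|\xi|^2}$. There is a constant $C>0$, depending only on $\phi$, such that for all $j,k\in\mathbb{Z}$ with $j\le k-10$ and all tempered distributions $u_0,v_0$ on $\mathbb{R}^2$ with $P_ju_0\in L^2(\mathbb{R}^2)$ and $P_kv_0\in L^2(\mathbb{R}^2)$, the functions $(t,x)\mapsto (e^{it\Delta}P_ju_0)(x)$ and $(t,x)\mapsto (e^{it\Delta}P_kv_0)(x)$ have jointly measurable versions on $\mathbb{R}\times\mathbb{R}^2$, and $$\|(e^{it\Delta}P_ju_0)(e^{it\Delta}P_kv_0)\|_{L^2_{t,x}(\mathbb{R}\times\mathbb{R}^2)}\le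 C\,2^{\frac{j-k}{2}}\,\|P_ju_0\|_{L^2(\mathbb{R}^2)}\,\|P_kv_0\|_{L^2(\mathbb{R}^2)}.$$ -/

import Mathlib

open MeasureTheory
open scoped SchwartzMap FourierTransform ENNReal ContDiff

/-- The plane `ℝ²` with its Euclidean norm and Lebesgue measure. -/
abbrev Plane : Type := EuclideanSpace ℝ (Fin 2)

/-- The complex Hilbert space `L²(ℝ²)`. -/
abbrev PlaneL2 : Type := Lp (α := Plane) ℂ 2

/-- A Littlewood–Paley bump function: a smooth, compactly supported `φ` on `ℝ²` with `φ = 1` on the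
closed unit disc. -/
structure IsLPBump (φ : Plane → ℂ) : Prop where
  contDiff : ContDiff ℝ ∞ φ
  hasCompactSupport : HasCompactSupport φ
  eq_one : ∀ ξ : Plane, ‖ξ‖ ≤ 1 → φ ξ = 1

/-- The annular cutoff `ψ(ξ) = φ(ξ/2) - φ(ξ)`. -/
noncomputable def lpCutoff (φ : Plane → ℂ) (ξ : Plane) : ℂ :=
  φ ((2 : ℝ)⁻¹ • ξ) - φ ξ

/-- The Littlewood–Paley projection `P_j f = 𝓕⁻¹(ψ(2⁻ʲ ξ) f̂(ξ))` of a tempered distribution, with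
`ξ` the angular frequency. Mathlib's Fourier transform has the kernel `exp(-2πi x·η)`, so that
`ξ = 2πη`. The symbol is smooth with compact support when `φ` is. -/
noncomputable def lpProj (φ : Plane → ℂ) (j : ℤ) (T : 𝓢'(Plane, ℂ)) : 𝓢'(Plane, ℂ) :=
  TemperedDistribution.fourierMultiplierCLM ℂ
    (fun η : Plane => lpCutoff φ ((2 : ℝ) ^ (-j) • (2 * Real.pi) • η)) T

/-- The symbol `exp(-it|ξ|²)` of `e^{itΔ}` at the angular frequency `ξ = 2πη`. -/
noncomputable def schrodingerSymbol (t : ℝ) (η : Plane) : ℂ :=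
  Complex.exp (-(Complex.I * ((t * ‖(2 * Real.pi) • η‖ ^ 2 : ℝ) : ℂ)))

theorem continuous_schrodingerSymbol (t : ℝ) : Continuous (schrodingerSymbol t) := by
  unfold schrodingerSymbol
  fun_prop

theorem norm_schrodingerSymbol (t : ℝ) (η : Plane) : ‖schrodingerSymbol t η‖ = 1 := by
  have h : -(Complex.I * ((t * ‖(2 * Real.pi) • η‖ ^ 2 : ℝ) : ℂ)) =
      ((-(t * ‖(2 * Real.pi) • η‖ ^ 2) : ℝ) : ℂ) * Complex.I := by
    push_cast
    ring
  rw [schrodingerSymbol, h, Complex.norm_exp_ofReal_mul_I]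

theorem memLp_schrodingerSymbol (t : ℝ) :
    MemLp (schrodingerSymbol t) ∞ (volume : Measure Plane) :=
  memLp_top_of_bound (continuous_schrodingerSymbol t).aestronglyMeasurable 1
    (Filter.Eventually.of_forall fun η => (norm_schrodingerSymbol t η).le)

/-- The free Schrödinger propagator `e^{itΔ}` on `L²(ℝ²)`: the Fourier multiplier with symbol
`exp(-it|ξ|²)`. -/
noncomputable def schrodinger (t : ℝ) (f : PlaneL2) : PlaneL2 :=
  𝓕⁻ (((memLp_schrodingerSymbol t).toLp (schrodingerSymbol t) • 𝓕 f : PlaneL2))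

/-- `u` is a jointly measurable function on `ℝ × ℝ²` that represents `(t, x) ↦ (e^{itΔ} f)(x)`.
Such a function is unique up to null sets of `ℝ × ℝ²`. -/
structure IsFreeEvolution (f : PlaneL2) (u : ℝ × Plane → ℂ) : Prop where
  aestronglyMeasurable : AEStronglyMeasurable u volume
  ae_eq : ∀ t : ℝ, (fun x : Plane => u (t, x)) =ᵐ[volume] schrodinger t f

/-! By Plancherel in `x`, it suffices to bound the spatial Fourier transform of the product. At
output frequency `σ` it is an integral over pairs `η`, `σ - η` of input frequencies. Writing them as
`c + y` and `c - y` with `c = σ/2`, the parallelogram law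
(`schrodingerSymbol_mul_schrodingerSymbol`) makes the time phase depend on `y` only through `|y|`,
up to a unimodular factor. In polar coordinates the time integral is therefore a one-dimensional
Fourier transform in `|y|²`, and Plancherel in `t` (`lintegral_radial_evolution_le`) leaves only the
integral over angles to control.

The gain comes from that angular integral. If `c + y` lies in a disc of radius `ρ` about the origin
and `c - y` at distance at least `l`, the admissible angles on each circle have measure `O(ρ/l)`
(`volume_angles_le`), and Cauchy–Schwarz in the angle yields this factor
(`lintegral_quadratic_phase_le`, `lintegral_interaction_le`). Integrating over `σ` separates the two
densities. For Littlewood–Paley pieces `ρ/l` is a multiple of `2 ^ (j - k)`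
(`fourier_ae_eq_zero_of_lpProj_eq`); a square root finishes the proof. -/

/-! ### Fourier integrals and Plancherel on `L¹ ∩ L²` -/

section Plancherel

variable {E : Type*} [NormedAddCommGroup E] [InnerProductSpace ℝ E] [FiniteDimensional ℝ E]
  [MeasurableSpace E] [BorelSpace E]

/-- The inverse Fourier integral is symmetric for the bilinear pairing of integrable functions. -/
theorem integral_fourierInv_mul_eq {f g : E → ℂ} (hf : Integrable f) (hg : Integrable g) :
    ∫ x, 𝓕⁻ f x * g x = ∫ x, f x * 𝓕⁻ g x := by
  -- Reflecting `g` turns both inverse transforms into forward ones.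
  have h := VectorFourier.integral_fourierIntegral_smul_eq_flip (μ := (volume : Measure E))
    (ν := (volume : Measure E)) (L := innerₗ E) Real.continuous_fourierChar
    (by simpa using continuous_inner) hf (hg.comp_neg)
  simp only [smul_eq_mul, flip_innerₗ] at h
  have h1 : ∫ x, 𝓕⁻ f x * g x = ∫ x, 𝓕 f x * g (-x) := by
    rw [← integral_neg_eq_self]
    simp [Real.fourierInv_eq_fourier_neg]
  have h2 : ∀ x, 𝓕⁻ g x = 𝓕 (fun y => g (-y)) x := fun x => by
    rw [Real.fourierInv_eq_fourier_comp_neg]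
  rw [h1]
  simp only [h2]
  exact h

/-- An `L²` function that represents the same tempered distribution as the continuous function `w`
agrees with `w` almost everywhere. -/
theorem Lp_ae_eq_of_toTemperedDistribution_eq (u : Lp (α := E) ℂ 2) {w : E → ℂ} (hw : Continuous w)
    (h : ∀ G : 𝓢(E, ℂ), Lp.toTemperedDistribution u G = ∫ x, G x * w x) : ∀ᵐ x, u x = w x := by
  apply ae_eq_of_integral_contDiff_smul_eq
    ((Lp.memLp u).locallyIntegrable (by norm_num)) hw.locallyIntegrable
  intro g g_smooth g_cpt
  have hg₁ : HasCompactSupport (Complex.ofRealCLM ∘ g) := g_cpt.comp_left rfl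
  have hg₂ : ContDiff ℝ ∞ (Complex.ofRealCLM ∘ g) := by fun_prop
  simpa using h (hg₁.toSchwartzMap hg₂)

theorem continuous_fourierInv_of_integrable {f : E → ℂ} (hf : Integrable f) :
    Continuous (𝓕⁻ f) := by
  rw [Real.fourierInv_eq_fourier_comp_neg]
  exact VectorFourier.fourierIntegral_continuous Real.continuous_fourierChar
    (innerSL ℝ).continuous₂ hf.comp_neg

/-- On `L¹ ∩ L²` the inverse Fourier transform of `L²` is given by the Fourier integral. -/
theorem fourierInv_toLp_ae_eq {f : E → ℂ} (hf : Integrable f) (hf2 : MemLp f 2) :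
    ∀ᵐ x, (𝓕⁻ (hf2.toLp f : Lp (α := E) ℂ 2) : Lp (α := E) ℂ 2) x = 𝓕⁻ f x := by
  apply Lp_ae_eq_of_toTemperedDistribution_eq _ (continuous_fourierInv_of_integrable hf)
  intro G
  rw [← Lp.fourierInv_toTemperedDistribution_eq, TemperedDistribution.fourierInv_apply,
    Lp.toTemperedDistribution_apply, ← integral_fourierInv_mul_eq G.integrable hf]
  apply integral_congr_ae
  filter_upwards [hf2.coeFn_toLp] with x hx
  rw [hx, SchwartzMap.fourierInv_coe, smul_eq_mul]

/-- Plancherel's inequality for the Fourier integral of an integrable function. -/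
theorem eLpNorm_fourierInv_le {f : E → ℂ} (hf : Integrable f) :
    eLpNorm (𝓕⁻ f) 2 volume ≤ eLpNorm f 2 volume := by
  by_cases h : eLpNorm f 2 volume = ⊤
  · rw [h]; exact le_top
  have hf2 : MemLp f 2 := ⟨hf.aestronglyMeasurable, lt_top_iff_ne_top.2 h⟩
  rw [← eLpNorm_congr_ae (fourierInv_toLp_ae_eq hf hf2), ← eLpNorm_congr_ae hf2.coeFn_toLp]
  have h3 : ‖(𝓕⁻ (hf2.toLp f : Lp (α := E) ℂ 2) : Lp (α := E) ℂ 2)‖ = ‖hf2.toLp f‖ :=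
    (Lp.fourierTransformₗᵢ E ℂ).symm.norm_map _
  rw [← Lp.enorm_def, ← Lp.enorm_def, ← ofReal_norm, ← ofReal_norm, h3]

theorem eLpNorm_fourier_le {f : E → ℂ} (hf : Integrable f) :
    eLpNorm (𝓕 f) 2 volume ≤ eLpNorm f 2 volume := by
  have h : 𝓕 f = 𝓕⁻ (fun x => f (-x)) := by
    ext x
    rw [Real.fourierInv_eq_fourier_comp_neg]
    simp
  rw [h]
  refine (eLpNorm_fourierInv_le hf.comp_neg).trans_eq ?_
  exact eLpNorm_comp_measurePreserving hf.aestronglyMeasurable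
    (Measure.measurePreserving_neg (volume : Measure E))

/-- The square of the `L²` norm as a lower Lebesgue integral. -/
theorem eLpNorm_two_sq {α F : Type*} [MeasurableSpace α] [NormedAddCommGroup F] (μ : Measure α)
    (f : α → F) : eLpNorm f 2 μ ^ 2 = ∫⁻ x, ‖f x‖ₑ ^ 2 ∂μ := by
  have h := eLpNorm_nnreal_pow_eq_lintegral (μ := μ) (f := f) (p := 2) (by norm_num)
  simpa using h

theorem lintegral_enorm_fourierInv_sq_le {f : E → ℂ} (hf : Integrable f) :
    ∫⁻ x, ‖𝓕⁻ f x‖ₑ ^ 2 ≤ ∫⁻ x, ‖f x‖ₑ ^ 2 := by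
  rw [← eLpNorm_two_sq, ← eLpNorm_two_sq]
  gcongr
  exact eLpNorm_fourierInv_le hf

theorem lintegral_enorm_fourier_sq_le {f : E → ℂ} (hf : Integrable f) :
    ∫⁻ x, ‖𝓕 f x‖ₑ ^ 2 ≤ ∫⁻ x, ‖f x‖ₑ ^ 2 := by
  rw [← eLpNorm_two_sq, ← eLpNorm_two_sq]
  gcongr
  exact eLpNorm_fourier_le hf

end Plancherel

/-! ### Frequency support of a multiplier image -/

/-- If a Fourier multiplier image of a tempered distribution is an `L²` function, then the Fourier
transform of that function vanishes on any open set where the symbol does. -/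
theorem fourier_ae_eq_zero_of_fourierMultiplier_eq {m : Plane → ℂ} (hm : m.HasTemperateGrowth)
    {T : 𝓢'(Plane, ℂ)} {f : PlaneL2}
    (h : TemperedDistribution.fourierMultiplierCLM ℂ m T = (f : 𝓢'(Plane, ℂ)))
    {U : Set Plane} (hU : IsOpen U) (hmU : ∀ η ∈ U, m η = 0) :
    ∀ᵐ η : Plane, η ∈ U → (𝓕 f : PlaneL2) η = 0 := by
  apply hU.ae_eq_zero_of_integral_contDiff_smul_eq_zero
    (((Lp.memLp _).locallyIntegrable (by norm_num)).locallyIntegrableOn _)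
  intro g g_smooth g_cpt g_supp
  have hg₁ : HasCompactSupport (Complex.ofRealCLM ∘ g) := g_cpt.comp_left rfl
  have hg₂ : ContDiff ℝ ∞ (Complex.ofRealCLM ∘ g) := by fun_prop
  set G : 𝓢(Plane, ℂ) := hg₁.toSchwartzMap hg₂ with hG
  have hGx : ∀ x, G x = (g x : ℂ) := fun x => rfl
  have hzero : SchwartzMap.smulLeftCLM ℂ m G = 0 := by
    ext x
    rw [SchwartzMap.smulLeftCLM_apply_apply hm, hGx]
    by_cases hx : x ∈ U
    · simp [hmU x hx]
    · have : g x = 0 := by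
        by_contra h0
        exact hx (g_supp (subset_tsupport _ h0))
      simp [this]
  calc ∫ x, g x • (𝓕 f : PlaneL2) x
      = Lp.toTemperedDistribution (𝓕 f : PlaneL2) G := by simp [hGx]
    _ = (𝓕 (TemperedDistribution.fourierMultiplierCLM ℂ m T)) G := by
        rw [← Lp.fourier_toTemperedDistribution_eq, h]
    _ = TemperedDistribution.smulLeftCLM ℂ m (𝓕 T) G := by
        rw [TemperedDistribution.fourierMultiplierCLM_apply, FourierTransform.fourier_fourierInv_eq]
    _ = 0 := by
        rw [TemperedDistribution.smulLeftCLM_apply_apply, hzero, map_zero]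

/-! ### Polar coordinates in the Euclidean plane -/

/-- The point of the plane with polar coordinates `p = (r, θ)`. -/
noncomputable def planePolar (p : ℝ × ℝ) : Plane :=
  !₂[p.1 * Real.cos p.2, p.1 * Real.sin p.2]

theorem continuous_planePolar : Continuous planePolar := by
  unfold planePolar
  fun_prop

@[fun_prop]
theorem measurable_planePolar : Measurable planePolar := continuous_planePolar.measurable

theorem norm_planePolar_sq (p : ℝ × ℝ) : ‖planePolar p‖ ^ 2 = p.1 ^ 2 := by
  rw [EuclideanSpace.norm_sq_eq]
  simp only [planePolar, Fin.sum_univ_two, Real.norm_eq_abs, sq_abs]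
  simp only [Matrix.cons_val_zero, Matrix.cons_val_one, Matrix.cons_val_fin_one]
  linear_combination p.1 ^ 2 * Real.sin_sq_add_cos_sq p.2

/-- The law of cosines for a chord; it converts closeness of two points on a circle into closeness
of their angles. -/
theorem norm_planePolar_sub_sq (r a b : ℝ) :
    ‖planePolar (r, a) - planePolar (r, b)‖ ^ 2 = 2 * r ^ 2 * (1 - Real.cos (a - b)) := by
  rw [EuclideanSpace.norm_sq_eq]
  simp only [planePolar, Fin.sum_univ_two, Real.norm_eq_abs, sq_abs, PiLp.sub_apply]
  simp only [Matrix.cons_val_zero, Matrix.cons_val_one, Matrix.cons_val_fin_one]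
  rw [Real.cos_sub]
  linear_combination r ^ 2 * Real.sin_sq_add_cos_sq a + r ^ 2 * Real.sin_sq_add_cos_sq b

/-- The identification of `ℝ × ℝ` with the Euclidean plane. -/
noncomputable def prodEquivPlane : ℝ × ℝ ≃ᵐ Plane :=
  (MeasurableEquiv.finTwoArrow (α := ℝ)).symm.trans (MeasurableEquiv.toLp 2 (Fin 2 → ℝ))

theorem measurePreserving_prodEquivPlane : MeasurePreserving prodEquivPlane :=
  ((PiLp.volume_preserving_toLp (Fin 2)).comp (volume_preserving_finTwoArrow ℝ).symm)

theorem prodEquivPlane_polarCoord_symm (p : ℝ × ℝ) :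
    prodEquivPlane (polarCoord.symm p) = planePolar p := by
  ext i
  fin_cases i <;> rfl

theorem lintegral_planePolar (F : Plane → ℝ≥0∞) :
    ∫⁻ p in Set.Ioi (0 : ℝ) ×ˢ Set.Ioo (-Real.pi) Real.pi,
      ENNReal.ofReal p.1 * F (planePolar p) = ∫⁻ y, F y := by
  rw [← measurePreserving_prodEquivPlane.lintegral_comp_emb
    prodEquivPlane.measurableEmbedding, ← lintegral_comp_polarCoord_symm]
  simp only [prodEquivPlane_polarCoord_symm, smul_eq_mul]
  rfl

theorem integral_planePolar (F : Plane → ℂ) :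
    ∫ p in Set.Ioi (0 : ℝ) ×ˢ Set.Ioo (-Real.pi) Real.pi,
      (p.1 : ℂ) * F (planePolar p) = ∫ y, F y := by
  rw [← measurePreserving_prodEquivPlane.integral_comp
    prodEquivPlane.measurableEmbedding, ← integral_comp_polarCoord_symm]
  simp only [prodEquivPlane_polarCoord_symm, Complex.real_smul]
  rfl

theorem integrableOn_planePolar {F : Plane → ℂ} (hF : Integrable F) (hFm : Measurable F) :
    IntegrableOn (fun p => (p.1 : ℂ) * F (planePolar p))
      (Set.Ioi (0 : ℝ) ×ˢ Set.Ioo (-Real.pi) Real.pi) := by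
  refine ⟨?_, ?_⟩
  · have := hFm.comp continuous_planePolar.measurable
    exact (Measurable.mul (by fun_prop) this).aestronglyMeasurable
  · rw [hasFiniteIntegral_iff_enorm]
    refine lt_of_eq_of_lt ?_ hF.hasFiniteIntegral
    rw [← lintegral_planePolar]
    refine setLIntegral_congr_fun (by measurability) fun p hp => ?_
    have hp1 : 0 < p.1 := hp.1
    simp only [enorm_mul]
    congr 1
    rw [← ofReal_norm, Complex.norm_real, Real.norm_of_nonneg hp1.le]

/-! ### Plancherel in time and Cauchy–Schwarz in the angle -/

theorem image_four_pi_mul_sq :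
    (fun r : ℝ => 4 * Real.pi * r ^ 2) '' Set.Ioi 0 = Set.Ioi 0 := by
  ext w
  constructor
  · rintro ⟨r, hr, rfl⟩
    have : (0 : ℝ) < r := hr
    exact Set.mem_Ioi.2 (by positivity)
  · intro hw
    have hw : 0 < w := hw
    refine ⟨√(w / (4 * Real.pi)), Set.mem_Ioi.2 (by positivity), ?_⟩
    simp only
    rw [Real.sq_sqrt (by positivity)]
    field_simp

/-- Plancherel in time for a radially parametrised superposition of free waves. -/
theorem lintegral_radial_evolution_le {M : ℝ → ℂ}
    (hM : IntegrableOn (fun r : ℝ => (r : ℂ) * M r) (Set.Ioi 0)) :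
    ∫⁻ t : ℝ, ‖∫ r in Set.Ioi (0 : ℝ),
        Complex.exp (-(8 * Real.pi ^ 2 * t * r ^ 2 : ℝ) * Complex.I) * ((r : ℂ) * M r)‖ₑ ^ 2 ≤
      ENNReal.ofReal (8 * Real.pi)⁻¹ *
        ∫⁻ r in Set.Ioi (0 : ℝ), ENNReal.ofReal r * ‖M r‖ₑ ^ 2 := by
  have hpi := Real.pi_pos
  -- The density in the variable `w = 4πr²`, chosen so that the kernel `exp(-2πi w t)` becomes
  -- `exp(-8π² i t r²)`. Since `dw = 8πr dr`, the weight `r` is absorbed and only `1/(8π)` remains.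
  set K₀ : ℝ → ℂ := fun w => ((8 * Real.pi)⁻¹ : ℝ) * M √(w / (4 * Real.pi)) with hK₀
  have hder : ∀ r ∈ Set.Ioi (0 : ℝ), HasDerivWithinAt (fun r : ℝ => 4 * Real.pi * r ^ 2)
      (8 * Real.pi * r) (Set.Ioi 0) r := by
    intro r _
    have := ((hasDerivAt_pow 2 r).const_mul (4 * Real.pi)).hasDerivWithinAt (s := Set.Ioi 0)
    rwa [show 4 * Real.pi * ((2 : ℕ) * r ^ (2 - 1)) = 8 * Real.pi * r by norm_num; ring] at this
  have hinj : Set.InjOn (fun r : ℝ => 4 * Real.pi * r ^ 2) (Set.Ioi 0) := by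
    intro a ha b hb hab
    have h1 : a ^ 2 = b ^ 2 := mul_left_cancel₀ (by positivity) hab
    exact (pow_left_inj₀ (le_of_lt ha) (le_of_lt hb) two_ne_zero).1 h1
  have hval : ∀ r ∈ Set.Ioi (0 : ℝ), K₀ (4 * Real.pi * r ^ 2) = ((8 * Real.pi)⁻¹ : ℝ) * M r := by
    intro r hr
    have : √(4 * Real.pi * r ^ 2 / (4 * Real.pi)) = r := by
      rw [mul_div_cancel_left₀ _ (by positivity)]
      exact Real.sqrt_sq (le_of_lt hr)
    simp only [hK₀, this]
  have hint : IntegrableOn K₀ (Set.Ioi 0) := by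
    rw [← image_four_pi_mul_sq,
      integrableOn_image_iff_integrableOn_abs_deriv_smul measurableSet_Ioi hder hinj]
    refine hM.congr_fun (fun r hr => ?_) measurableSet_Ioi
    have hr' : (0 : ℝ) < r := hr
    simp only
    rw [hval r hr, abs_of_pos (by positivity)]
    simp only [Complex.real_smul]
    push_cast
    field_simp
  have hK : Integrable ((Set.Ioi 0).indicator K₀) := hint.integrable_indicator measurableSet_Ioi
  have hfour : ∀ t : ℝ, 𝓕 ((Set.Ioi 0).indicator K₀) t = ∫ r in Set.Ioi (0 : ℝ),
      Complex.exp (-(8 * Real.pi ^ 2 * t * r ^ 2 : ℝ) * Complex.I) * ((r : ℂ) * M r) := by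
    intro t
    rw [Real.fourier_real_eq_integral_exp_smul]
    have : ∀ v : ℝ, Complex.exp (↑(-2 * Real.pi * v * t) * Complex.I) •
        (Set.Ioi 0).indicator K₀ v =
        (Set.Ioi 0).indicator (fun v : ℝ => Complex.exp (↑(-2 * Real.pi * v * t) * Complex.I) •
          K₀ v) v := fun v => by
      by_cases hv : v ∈ Set.Ioi (0 : ℝ) <;> simp [hv, Set.indicator]
    simp_rw [this]
    have hsub := integral_image_eq_integral_abs_deriv_smul measurableSet_Ioi hder hinj
      (fun v : ℝ => Complex.exp (↑(-2 * Real.pi * v * t) * Complex.I) • K₀ v)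
    rw [image_four_pi_mul_sq] at hsub
    rw [integral_indicator measurableSet_Ioi, hsub]
    refine setIntegral_congr_fun measurableSet_Ioi fun r hr => ?_
    have hr' : (0 : ℝ) < r := hr
    rw [hval r hr, abs_of_pos (by positivity)]
    simp only [Complex.real_smul, smul_eq_mul]
    have e1 : ((-2 * Real.pi * (4 * Real.pi * r ^ 2) * t : ℝ) : ℂ) * Complex.I =
        -(8 * Real.pi ^ 2 * t * r ^ 2 : ℝ) * Complex.I := by
      push_cast; ring
    rw [e1]
    push_cast
    field_simp
  simp_rw [← hfour]
  refine (lintegral_enorm_fourier_sq_le hK).trans_eq ?_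
  have : ∀ v : ℝ, ‖(Set.Ioi 0).indicator K₀ v‖ₑ ^ 2 =
      (Set.Ioi 0).indicator (fun v => ‖K₀ v‖ₑ ^ 2) v := fun v => by
    by_cases hv : v ∈ Set.Ioi (0 : ℝ) <;> simp [hv, Set.indicator]
  simp_rw [this]
  have hsub := lintegral_image_eq_lintegral_abs_deriv_mul measurableSet_Ioi hder hinj
    (fun v => ‖K₀ v‖ₑ ^ 2)
  rw [image_four_pi_mul_sq] at hsub
  rw [lintegral_indicator measurableSet_Ioi, hsub, ← lintegral_const_mul' _ _ ENNReal.ofReal_ne_top]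
  refine setLIntegral_congr_fun measurableSet_Ioi fun r hr => ?_
  have hr' : (0 : ℝ) < r := hr
  rw [hval r hr, abs_of_pos (by positivity), enorm_mul, mul_pow, ← mul_assoc, ← mul_assoc]
  congr 1
  rw [← ofReal_norm, Complex.norm_real, Real.norm_of_nonneg (by positivity),
    ← ENNReal.ofReal_pow (by positivity), ← ENNReal.ofReal_mul (by positivity),
    ← ENNReal.ofReal_mul (by positivity)]
  congr 1
  field_simp

/-- Cauchy–Schwarz for an integrand with support of finite measure. -/
theorem lintegral_enorm_sq_le_measure_support_mul {α : Type*} [MeasurableSpace α] (μ : Measure α)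
    {f : α → ℂ} (hf : Measurable f) :
    (∫⁻ x, ‖f x‖ₑ ∂μ) ^ 2 ≤ μ {x | f x ≠ 0} * ∫⁻ x, ‖f x‖ₑ ^ 2 ∂μ := by
  have hS : MeasurableSet {x | f x ≠ 0} := (measurableSet_eq_fun hf measurable_const).compl
  have h := ENNReal.lintegral_mul_le_Lp_mul_Lq μ Real.HolderConjugate.two_two
    (f := fun x => ‖f x‖ₑ) (g := Set.indicator {x | f x ≠ 0} 1) hf.enorm.aemeasurable
    (measurable_one.indicator hS).aemeasurable
  have h1 : ∀ x, ((fun x => ‖f x‖ₑ) * Set.indicator {x | f x ≠ 0} (1 : α → ℝ≥0∞) : α → ℝ≥0∞) x = ‖f x‖ₑ := by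
    intro x
    by_cases hx : f x = 0 <;> simp [hx, Set.indicator]
  have h2 : ∀ x, (Set.indicator {x | f x ≠ 0} (1 : α → ℝ≥0∞) x) ^ (2 : ℝ) =
      Set.indicator {x | f x ≠ 0} 1 x := by
    intro x
    by_cases hx : f x = 0 <;> simp [hx, Set.indicator]
  simp_rw [h1, h2, lintegral_indicator_one hS] at h
  have h3 : ∀ a : ℝ≥0∞, (a ^ (1 / 2 : ℝ)) ^ 2 = a := fun a => by
    rw [← ENNReal.rpow_natCast, ← ENNReal.rpow_mul]; simp
  calc (∫⁻ x, ‖f x‖ₑ ∂μ) ^ 2 ≤ _ := pow_le_pow_left₀ zero_le h 2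
    _ = _ := by
      rw [mul_pow, h3, h3, mul_comm]
      simp

/-- The time-space bound behind the bilinear estimate: if on each circle about the origin the
function `G` is supported on a set of angles of measure at most `Θ`, its quadratic oscillatory
integrals are square integrable in time, with a gain of `Θ`. -/
theorem lintegral_quadratic_phase_le {G : Plane → ℂ} (hG : Integrable G) (hGm : Measurable G)
    {Θ : ℝ≥0∞} (hΘ : ∀ r : ℝ, 0 < r →
      volume {θ ∈ Set.Ioo (-Real.pi) Real.pi | G (planePolar (r, θ)) ≠ 0} ≤ Θ) :
    ∫⁻ t : ℝ, ‖∫ y : Plane,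
        Complex.exp (-(8 * Real.pi ^ 2 * t * ‖y‖ ^ 2 : ℝ) * Complex.I) * G y‖ₑ ^ 2 ≤
      ENNReal.ofReal (8 * Real.pi)⁻¹ * (Θ * ∫⁻ y, ‖G y‖ₑ ^ 2) := by
  set S : Set ℝ := Set.Ioo (-Real.pi) Real.pi with hS
  set M : ℝ → ℂ := fun r => ∫ θ in S, G (planePolar (r, θ)) with hM
  have hGp : Measurable fun p => G (planePolar p) := hGm.comp continuous_planePolar.measurable
  have hvol : (volume : Measure (ℝ × ℝ)).restrict (Set.Ioi (0 : ℝ) ×ˢ S) =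
      ((volume : Measure ℝ).restrict (Set.Ioi 0)).prod ((volume : Measure ℝ).restrict S) := by
    rw [Measure.prod_restrict, Measure.volume_eq_prod]
  have key : ∀ t : ℝ, ∫ y : Plane,
        Complex.exp (-(8 * Real.pi ^ 2 * t * ‖y‖ ^ 2 : ℝ) * Complex.I) * G y =
      ∫ r in Set.Ioi (0 : ℝ),
        Complex.exp (-(8 * Real.pi ^ 2 * t * r ^ 2 : ℝ) * Complex.I) * ((r : ℂ) * M r) := by
    intro t
    have hm : Measurable fun y : Plane =>
        Complex.exp (-(8 * Real.pi ^ 2 * t * ‖y‖ ^ 2 : ℝ) * Complex.I) := by fun_prop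
    have hI : Integrable fun y : Plane =>
        Complex.exp (-(8 * Real.pi ^ 2 * t * ‖y‖ ^ 2 : ℝ) * Complex.I) * G y := by
      refine hG.bdd_mul (c := 1) hm.aestronglyMeasurable (Filter.Eventually.of_forall fun y => ?_)
      rw [← Complex.ofReal_neg, Complex.norm_exp_ofReal_mul_I]
    rw [← integral_planePolar]
    have hIp := integrableOn_planePolar hI (hm.mul hGm)
    rw [IntegrableOn, hvol] at hIp
    rw [hvol, integral_prod _ hIp]
    refine setIntegral_congr_fun measurableSet_Ioi fun r hr => ?_
    simp only [norm_planePolar_sq, hM]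
    rw [← integral_const_mul, ← integral_const_mul]
    refine integral_congr_ae (Filter.Eventually.of_forall fun θ => ?_)
    simp only
    ring
  have hMint : IntegrableOn (fun r : ℝ => (r : ℂ) * M r) (Set.Ioi 0) := by
    have hIp := integrableOn_planePolar hG hGm
    rw [IntegrableOn, hvol] at hIp
    have := hIp.integral_prod_left
    simp only [integral_const_mul] at this
    exact this
  simp_rw [key]
  refine (lintegral_radial_evolution_le hMint).trans ?_
  gcongr
  -- Cauchy–Schwarz on each circle, where the angular support has measure at most `Θ`.
  have hMle : ∀ r ∈ Set.Ioi (0 : ℝ), ENNReal.ofReal r * ‖M r‖ₑ ^ 2 ≤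
      Θ * ∫⁻ θ in S, ENNReal.ofReal r * ‖G (planePolar (r, θ))‖ₑ ^ 2 := by
    intro r hr
    have hGr : Measurable fun θ => G (planePolar (r, θ)) := hGp.comp measurable_prodMk_left
    rw [lintegral_const_mul' _ _ ENNReal.ofReal_ne_top, mul_left_comm]
    gcongr
    calc ‖M r‖ₑ ^ 2 ≤ (∫⁻ θ in S, ‖G (planePolar (r, θ))‖ₑ) ^ 2 := by
          gcongr; exact enorm_integral_le_lintegral_enorm _
      _ ≤ _ := lintegral_enorm_sq_le_measure_support_mul _ hGr
      _ ≤ _ := by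
        gcongr
        rw [Measure.restrict_apply' measurableSet_Ioo]
        refine le_trans (measure_mono ?_) (hΘ r hr)
        exact fun θ hθ => ⟨hθ.2, hθ.1⟩
  calc ∫⁻ r in Set.Ioi (0 : ℝ), ENNReal.ofReal r * ‖M r‖ₑ ^ 2
      ≤ ∫⁻ r in Set.Ioi (0 : ℝ), Θ * ∫⁻ θ in S, ENNReal.ofReal r * ‖G (planePolar (r, θ))‖ₑ ^ 2 :=
        setLIntegral_mono' measurableSet_Ioi hMle
    _ = Θ * ∫⁻ r in Set.Ioi (0 : ℝ), ∫⁻ θ in S,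
          ENNReal.ofReal r * ‖G (planePolar (r, θ))‖ₑ ^ 2 := by
        rw [lintegral_const_mul]
        exact Measurable.lintegral_prod_right'
          (f := fun p : ℝ × ℝ => ENNReal.ofReal p.1 * ‖G (planePolar p)‖ₑ ^ 2) (by fun_prop)
    _ = Θ * ∫⁻ y, ‖G y‖ₑ ^ 2 := by
        rw [← lintegral_planePolar, hvol, lintegral_prod]
        exact Measurable.aemeasurable (by fun_prop)

/-! ### The arc estimate -/

/-- A circle centred at `c` meets a small disc about the origin, with antipode far from the origin,
in a short arc. -/
theorem volume_angles_le (c : Plane) {ρ l r : ℝ} (hρ : 0 < ρ) (hl : 0 < l) (hr : 0 < r) :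
    volume {θ ∈ Set.Ioo (-Real.pi) Real.pi |
      ‖c + planePolar (r, θ)‖ ≤ ρ ∧ l ≤ ‖c - planePolar (r, θ)‖} ≤
      ENNReal.ofReal (24 * Real.pi * (ρ / l)) := by
  have hpi := Real.pi_pos
  set S := {θ ∈ Set.Ioo (-Real.pi) Real.pi |
      ‖c + planePolar (r, θ)‖ ≤ ρ ∧ l ≤ ‖c - planePolar (r, θ)‖} with hS
  -- Without separation of the scales the full circle suffices: `2π ≤ 24π · (1/2)`.
  by_cases hlρ : l < 2 * ρ
  · calc volume S ≤ volume (Set.Ioo (-Real.pi) Real.pi) := measure_mono fun θ hθ => hθ.1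
      _ = ENNReal.ofReal (2 * Real.pi) := by rw [Real.volume_Ioo]; congr 1; ring
      _ ≤ _ := by
        apply ENNReal.ofReal_le_ofReal
        have : 1 / 2 ≤ ρ / l := by rw [div_le_div_iff₀ (by norm_num) hl]; linarith
        nlinarith
  push Not at hlρ
  obtain hemp | ⟨a, ha⟩ := S.eq_empty_or_nonempty
  · simp [hemp]
  have hnorm : ‖planePolar (r, a)‖ = r := by
    have := norm_planePolar_sq (r, a)
    exact (pow_left_inj₀ (norm_nonneg _) hr.le two_ne_zero).1 this
  -- The points `c + y` and `c - y` differ by `2y`, so `2r ≥ l - ρ ≥ l/2`.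
  have hrl : l / 4 ≤ r := by
    have h1 : ‖c - planePolar (r, a)‖ ≤ ‖c + planePolar (r, a)‖ + 2 * r := by
      have : c - planePolar (r, a) = (c + planePolar (r, a)) - (2 : ℝ) • planePolar (r, a) := by
        rw [two_smul]; abel
      rw [this]
      refine (norm_sub_le _ _).trans ?_
      rw [norm_smul, hnorm, Real.norm_of_nonneg zero_le_two]
    have h2 := ha.2.1
    have h3 := ha.2.2
    linarith
  -- Two admissible points are at most `2ρ` apart on a circle of radius at least `l/4`. This `d` is
  -- the resulting angular bound from `1 - cos x ≥ (2/π²) x²`.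
  set d := 4 * Real.pi * (ρ / l) with hd
  have hd0 : 0 < d := by positivity
  have hcos : ∀ θ ∈ S, 1 - Real.cos (θ - a) ≤ 2 / Real.pi ^ 2 * d ^ 2 := by
    intro θ hθ
    have h1 : ‖planePolar (r, θ) - planePolar (r, a)‖ ≤ 2 * ρ := by
      have : planePolar (r, θ) - planePolar (r, a) =
        (c + planePolar (r, θ)) - (c + planePolar (r, a)) := by abel
      rw [this]
      refine (norm_sub_le _ _).trans ?_
      linarith [hθ.2.1, ha.2.1]
    have h2 := norm_planePolar_sub_sq r θ a
    have h3 : 2 * r ^ 2 * (1 - Real.cos (θ - a)) ≤ (2 * ρ) ^ 2 := by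
      rw [← h2]; gcongr
    have h4 : 0 ≤ 1 - Real.cos (θ - a) := by linarith [Real.cos_le_one (θ - a)]
    have h5 : 2 * (l / 4) ^ 2 * (1 - Real.cos (θ - a)) ≤ (2 * ρ) ^ 2 := by
      refine le_trans ?_ h3
      gcongr
    have h6 : 2 / Real.pi ^ 2 * d ^ 2 = (2 * ρ) ^ 2 / (2 * (l / 4) ^ 2) := by
      rw [hd]; field_simp
    rw [h6, le_div_iff₀ (by positivity)]
    linarith
  have hsmall : ∀ x : ℝ, |x| ≤ Real.pi → 1 - Real.cos x ≤ 2 / Real.pi ^ 2 * d ^ 2 → |x| ≤ d := by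
    intro x hx h
    have h1 := Real.cos_le_one_sub_mul_cos_sq hx
    have h2 : 2 / Real.pi ^ 2 * x ^ 2 ≤ 2 / Real.pi ^ 2 * d ^ 2 := by linarith
    have h3 : x ^ 2 ≤ d ^ 2 := le_of_mul_le_mul_left h2 (by positivity)
    exact abs_le_of_sq_le_sq h3 hd0.le
  -- Differences of angles in `(-π, π)` range over `(-2π, 2π)`, so the arc may wrap around; three
  -- intervals of length `2d` give the total `6d = 24π ρ/l`.
  have hsub : S ⊆ Set.Icc (a - d) (a + d) ∪
      (Set.Icc (a + 2 * Real.pi - d) (a + 2 * Real.pi + d) ∪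
        Set.Icc (a - 2 * Real.pi - d) (a - 2 * Real.pi + d)) := by
    intro θ hθ
    have h1 := hcos θ hθ
    have hθ1 := hθ.1
    have ha1 := ha.1
    rw [Set.mem_Ioo] at hθ1 ha1
    by_cases hx : |θ - a| ≤ Real.pi
    · left
      have := abs_le.1 (hsmall _ hx h1)
      constructor <;> linarith
    right
    rcases le_total (θ - a) 0 with h0 | h0
    · right
      rw [abs_of_nonpos h0] at hx
      have h2 : |θ - a + 2 * Real.pi| ≤ Real.pi := by rw [abs_le]; constructor <;> linarith
      rw [← Real.cos_add_two_pi] at h1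
      have := abs_le.1 (hsmall _ h2 h1)
      constructor <;> linarith
    · left
      rw [abs_of_nonneg h0] at hx
      have h2 : |θ - a - 2 * Real.pi| ≤ Real.pi := by rw [abs_le]; constructor <;> linarith
      rw [← Real.cos_sub_two_pi] at h1
      have := abs_le.1 (hsmall _ h2 h1)
      constructor <;> linarith
  refine (measure_mono hsub).trans ((measure_union_le _ _).trans
    ((add_le_add_right (measure_union_le _ _) _).trans ?_))
  rw [Real.volume_Icc, Real.volume_Icc, Real.volume_Icc, ← ENNReal.ofReal_add, ← ENNReal.ofReal_add]
  · apply ENNReal.ofReal_le_ofReal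
    rw [hd]
    linarith
  all_goals linarith

/-! ### The bilinear interaction of two free waves -/

/-- By the parallelogram law the cross terms in `c` and `y` cancel. The factor in `c` is unimodular
and disappears on taking norms; the one in `y` is radial. -/
theorem schrodingerSymbol_mul_schrodingerSymbol (t : ℝ) (c y : Plane) :
    schrodingerSymbol t (c + y) * schrodingerSymbol t (c - y) =
      Complex.exp ((-(8 * Real.pi ^ 2 * t * ‖c‖ ^ 2) : ℝ) * Complex.I) *
        Complex.exp (-(8 * Real.pi ^ 2 * t * ‖y‖ ^ 2 : ℝ) * Complex.I) := by
  have h := parallelogram_law_with_norm ℝ c y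
  simp only [schrodingerSymbol, ← Complex.exp_add, norm_smul, mul_pow, Real.norm_eq_abs, sq_abs]
  congr 1
  have h' : ((‖c + y‖ ^ 2 + ‖c - y‖ ^ 2 : ℝ) : ℂ) = (2 * (‖c‖ ^ 2 + ‖y‖ ^ 2) : ℝ) := congrArg _ h
  push_cast at h' ⊢
  linear_combination (-4 * Complex.I * t * Real.pi ^ 2) * h'

theorem measurable_uncurry_schrodingerSymbol :
    Measurable fun p : ℝ × Plane => schrodingerSymbol p.1 p.2 := by
  unfold schrodingerSymbol
  fun_prop

theorem integrable_schrodingerSymbol_mul {A : Plane → ℂ} (hA : Integrable A) (t : ℝ) :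
    Integrable fun η => schrodingerSymbol t η * A η :=
  hA.bdd_mul (c := 1) (continuous_schrodingerSymbol t).aestronglyMeasurable
    (Filter.Eventually.of_forall fun η => (norm_schrodingerSymbol t η).le)

section Bilinear

variable {A B : Plane → ℂ}

/-- The time integral of the interaction at a fixed output frequency `σ`. -/
theorem lintegral_interaction_le (hAm : Measurable A) (hBm : Measurable B)
    (hA2 : MemLp A 2) (hB2 : MemLp B 2) {ρ l : ℝ} (hρ : 0 < ρ) (hl : 0 < l)
    (hAρ : ∀ η, A η ≠ 0 → ‖η‖ ≤ ρ) (hBl : ∀ η, B η ≠ 0 → l ≤ ‖η‖) (σ : Plane) :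
    ∫⁻ t : ℝ, ‖∫ η, (schrodingerSymbol t η * A η) *
        (schrodingerSymbol t (σ - η) * B (σ - η))‖ₑ ^ 2 ≤
      ENNReal.ofReal (3 * (ρ / l)) * ∫⁻ η, ‖A η‖ₑ ^ 2 * ‖B (σ - η)‖ₑ ^ 2 := by
  set c : Plane := (2 : ℝ)⁻¹ • σ with hc
  have hσ : ∀ y, σ - (c + y) = c - y := fun y => by
    have : σ = c + c := by rw [hc, ← add_smul]; norm_num
    rw [this]; abel
  set G : Plane → ℂ := fun y => A (c + y) * B (c - y) with hG
  have hGm : Measurable G := by fun_prop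
  -- A product of two `L²` functions, since translation and reflection preserve the measure.
  have hGi : Integrable G :=
    (hA2.comp_measurePreserving (measurePreserving_add_left volume c)).integrable_mul
      (hB2.comp_measurePreserving (volume.measurePreserving_sub_left c))
  have hΘ : ∀ r : ℝ, 0 < r → volume {θ ∈ Set.Ioo (-Real.pi) Real.pi | G (planePolar (r, θ)) ≠ 0} ≤
      ENNReal.ofReal (24 * Real.pi * (ρ / l)) := fun r hr => by
    refine le_trans (measure_mono ?_) (volume_angles_le c hρ hl hr)
    exact fun θ hθ => ⟨hθ.1, hAρ _ (left_ne_zero_of_mul hθ.2), hBl _ (right_ne_zero_of_mul hθ.2)⟩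
  have hphase : ∀ t : ℝ, ‖∫ η, (schrodingerSymbol t η * A η) *
      (schrodingerSymbol t (σ - η) * B (σ - η))‖ₑ = ‖∫ y : Plane,
        Complex.exp (-(8 * Real.pi ^ 2 * t * ‖y‖ ^ 2 : ℝ) * Complex.I) * G y‖ₑ := by
    intro t
    rw [← integral_add_left_eq_self _ c]
    have : ∀ y, (schrodingerSymbol t (c + y) * A (c + y)) *
        (schrodingerSymbol t (σ - (c + y)) * B (σ - (c + y))) =
        Complex.exp ((-(8 * Real.pi ^ 2 * t * ‖c‖ ^ 2) : ℝ) * Complex.I) *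
        (Complex.exp (-(8 * Real.pi ^ 2 * t * ‖y‖ ^ 2 : ℝ) * Complex.I) * G y) := fun y => by
      rw [hσ, ← mul_assoc _ _ (G y), ← schrodingerSymbol_mul_schrodingerSymbol]
      simp only [hG]
      ring
    simp_rw [this]
    rw [integral_const_mul, enorm_mul, ← ofReal_norm, Complex.norm_exp_ofReal_mul_I]
    simp
  simp_rw [hphase]
  refine (lintegral_quadratic_phase_le hGi hGm hΘ).trans_eq ?_
  rw [← mul_assoc, ← ENNReal.ofReal_mul (by positivity)]
  congr 1
  · congr 1
    -- The constant is `24π / (8π) = 3`.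
    field_simp
    norm_num
  · rw [← lintegral_add_left_eq_self (fun η => ‖A η‖ₑ ^ 2 * ‖B (σ - η)‖ₑ ^ 2) c]
    simp only [hσ, hG, enorm_mul, mul_pow]

/-- The bilinear estimate for free waves with given spectral densities. -/
theorem lintegral_fourierInv_mul_fourierInv_le (hAm : Measurable A) (hBm : Measurable B)
    (hA1 : Integrable A) (hB1 : Integrable B)
    (hA2 : MemLp A 2) (hB2 : MemLp B 2) {ρ l : ℝ} (hρ : 0 < ρ) (hl : 0 < l)
    (hAρ : ∀ η, A η ≠ 0 → ‖η‖ ≤ ρ) (hBl : ∀ η, B η ≠ 0 → l ≤ ‖η‖) :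
    ∫⁻ t : ℝ, ∫⁻ x : Plane, ‖𝓕⁻ (fun η => schrodingerSymbol t η * A η) x *
        𝓕⁻ (fun η => schrodingerSymbol t η * B η) x‖ₑ ^ 2 ≤
      ENNReal.ofReal (3 * (ρ / l)) * ((∫⁻ η, ‖A η‖ₑ ^ 2) * ∫⁻ η, ‖B η‖ₑ ^ 2) := by
  -- The product is the inverse transform of a convolution, so Plancherel in `x` applies at each
  -- time.
  have hconv : ∀ t : ℝ, ∫⁻ x : Plane, ‖𝓕⁻ (fun η => schrodingerSymbol t η * A η) x *
        𝓕⁻ (fun η => schrodingerSymbol t η * B η) x‖ₑ ^ 2 ≤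
      ∫⁻ σ, ‖∫ η, (schrodingerSymbol t η * A η) *
        (schrodingerSymbol t (σ - η) * B (σ - η))‖ₑ ^ 2 := by
    intro t
    have hA := integrable_schrodingerSymbol_mul hA1 t
    have hB := integrable_schrodingerSymbol_mul hB1 t
    have hc := hA.integrable_convolution (ContinuousLinearMap.mul ℂ ℂ) hB
    refine le_trans (le_of_eq ?_) (lintegral_enorm_fourierInv_sq_le hc)
    refine lintegral_congr fun x => ?_
    rw [Real.fourierInv_eq_fourier_neg, Real.fourierInv_eq_fourier_neg,
      Real.fourierInv_eq_fourier_neg, ← Real.fourier_mul_convolution_eq hA hB]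
    rfl
  have hmeas : Measurable fun p : ℝ × Plane => ‖∫ η, (schrodingerSymbol p.1 η * A η) *
        (schrodingerSymbol p.1 (p.2 - η) * B (p.2 - η))‖ₑ ^ 2 := by
    have h1 : Measurable fun q : (ℝ × Plane) × Plane => schrodingerSymbol q.1.1 q.2 :=
      measurable_uncurry_schrodingerSymbol.comp (f := fun q : (ℝ × Plane) × Plane => (q.1.1, q.2))
        (by fun_prop)
    have h2 : Measurable fun q : (ℝ × Plane) × Plane => schrodingerSymbol q.1.1 (q.1.2 - q.2) :=
      measurable_uncurry_schrodingerSymbol.comp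
        (f := fun q : (ℝ × Plane) × Plane => (q.1.1, q.1.2 - q.2)) (by fun_prop)
    have h3 : Measurable fun q : (ℝ × Plane) × Plane => (schrodingerSymbol q.1.1 q.2 * A q.2) *
        (schrodingerSymbol q.1.1 (q.1.2 - q.2) * B (q.1.2 - q.2)) := by fun_prop
    exact (h3.stronglyMeasurable.integral_prod_right').measurable.enorm.pow_const 2
  calc _ ≤ ∫⁻ t : ℝ, ∫⁻ σ, ‖∫ η, (schrodingerSymbol t η * A η) *
        (schrodingerSymbol t (σ - η) * B (σ - η))‖ₑ ^ 2 := lintegral_mono hconv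
    _ = ∫⁻ σ, ∫⁻ t : ℝ, ‖∫ η, (schrodingerSymbol t η * A η) *
        (schrodingerSymbol t (σ - η) * B (σ - η))‖ₑ ^ 2 :=
      lintegral_lintegral_swap hmeas.aemeasurable
    _ ≤ ∫⁻ σ, ENNReal.ofReal (3 * (ρ / l)) * ∫⁻ η, ‖A η‖ₑ ^ 2 * ‖B (σ - η)‖ₑ ^ 2 :=
      lintegral_mono fun σ => lintegral_interaction_le hAm hBm hA2 hB2 hρ hl hAρ hBl σ
    _ = ENNReal.ofReal (3 * (ρ / l)) * ∫⁻ σ, ∫⁻ η, ‖A η‖ₑ ^ 2 * ‖B (σ - η)‖ₑ ^ 2 :=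
      lintegral_const_mul' _ _ ENNReal.ofReal_ne_top
    _ = _ := by
      congr 1
      -- Integrating in `σ` first, translation invariance makes the mass of `B` independent of `η`.
      rw [lintegral_lintegral_swap (by fun_prop), ← lintegral_mul_const _ (by fun_prop)]
      refine lintegral_congr fun η => ?_
      rw [lintegral_const_mul _ (by fun_prop), lintegral_sub_right_eq_self (fun σ => ‖B σ‖ₑ ^ 2) η]

end Bilinear

/-! ### Free evolutions of `L²` data with spectrum of finite measure -/

/-- The spectral density of `f` cut off to the set `S`. -/
noncomputable def spectralDensity (S : Set Plane) (f : PlaneL2) : Plane → ℂ :=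
  S.indicator (𝓕 f : PlaneL2)

section SpectralDensity

variable {S : Set Plane} {f : PlaneL2}

theorem measurable_spectralDensity (hS : MeasurableSet S) : Measurable (spectralDensity S f) :=
  (Lp.stronglyMeasurable _).measurable.indicator hS

theorem memLp_spectralDensity (hS : MeasurableSet S) : MemLp (spectralDensity S f) 2 :=
  (Lp.memLp _).indicator hS

theorem integrable_spectralDensity (hS : MeasurableSet S) (hS' : volume S ≠ ⊤) :
    Integrable (spectralDensity S f) := by
  have : IsFiniteMeasure ((volume : Measure Plane).restrict S) :=
    ⟨by simpa using hS'.lt_top⟩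
  rw [spectralDensity, integrable_indicator_iff hS]
  exact ((Lp.memLp (𝓕 f : PlaneL2)).restrict S).integrable (by norm_num)

theorem lintegral_enorm_spectralDensity_sq_le (S : Set Plane) (f : PlaneL2) :
    ∫⁻ η, ‖spectralDensity S f η‖ₑ ^ 2 ≤ ENNReal.ofReal (‖f‖ ^ 2) := by
  calc ∫⁻ η, ‖spectralDensity S f η‖ₑ ^ 2 ≤ ∫⁻ η, ‖(𝓕 f : PlaneL2) η‖ₑ ^ 2 := by
        gcongr with η
        exact enorm_indicator_le_enorm_self _ _
    _ = ENNReal.ofReal (‖f‖ ^ 2) := by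
        rw [← eLpNorm_two_sq, ← Lp.enorm_def, ← ofReal_norm, Lp.norm_fourier_eq,
          ENNReal.ofReal_pow (norm_nonneg _)]

/-- The free evolution of a function whose spectrum lies in a set of finite measure is given by a
Fourier integral. -/
theorem schrodinger_ae_eq_fourierInv (hS : MeasurableSet S) (hS' : volume S ≠ ⊤)
    (hf : ∀ᵐ η : Plane, η ∉ S → (𝓕 f : PlaneL2) η = 0) (t : ℝ) :
    ∀ᵐ x, schrodinger t f x =
      𝓕⁻ (fun η => schrodingerSymbol t η * spectralDensity S f η) x := by
  have h2 : MemLp (fun η => schrodingerSymbol t η * spectralDensity S f η) 2 :=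
    (memLp_spectralDensity hS).mul' (memLp_schrodingerSymbol t)
  have heq : ((memLp_schrodingerSymbol t).toLp (schrodingerSymbol t) • 𝓕 f : PlaneL2) =
      h2.toLp _ := by
    apply Lp.ext
    filter_upwards [Lp.coeFn_lpSMul (r := 2) ((memLp_schrodingerSymbol t).toLp _) (𝓕 f : PlaneL2),
      (memLp_schrodingerSymbol t).coeFn_toLp, h2.coeFn_toLp, hf] with η h₁ h₃ h₄ h₅
    rw [h₁, h₄, Pi.smul_apply', h₃, smul_eq_mul, spectralDensity]
    by_cases hη : η ∈ S
    · simp [hη]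
    · simp [hη, h₅ hη]
  rw [schrodinger, heq]
  exact fourierInv_toLp_ae_eq
    (integrable_schrodingerSymbol_mul (integrable_spectralDensity hS hS') t) h2

/-- The Fourier integral of the evolved density is an explicit version; it is jointly measurable as
a parametrised integral of a jointly measurable integrand. -/
theorem exists_isFreeEvolution (hS : MeasurableSet S) (hS' : volume S ≠ ⊤)
    (hf : ∀ᵐ η : Plane, η ∉ S → (𝓕 f : PlaneL2) η = 0) : ∃ u, IsFreeEvolution f u := by
  refine ⟨fun z => 𝓕⁻ (fun η => schrodingerSymbol z.1 η * spectralDensity S f η) z.2, ?_,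
    fun t => ?_⟩
  · have h1 : Measurable fun q : (ℝ × Plane) × Plane => schrodingerSymbol q.1.1 q.2 :=
      measurable_uncurry_schrodingerSymbol.comp (f := fun q : (ℝ × Plane) × Plane => (q.1.1, q.2))
        (by fun_prop)
    have h2 : Measurable fun q : (ℝ × Plane) × Plane => spectralDensity S f q.2 :=
      (measurable_spectralDensity hS).comp measurable_snd
    have h3 : Measurable fun q : (ℝ × Plane) × Plane =>
        Complex.exp ((2 * Real.pi * inner ℝ q.2 q.1.2 : ℝ) * Complex.I) *
          (schrodingerSymbol q.1.1 q.2 * spectralDensity S f q.2) := by fun_prop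
    simp_rw [Real.fourierInv_eq', smul_eq_mul]
    exact h3.stronglyMeasurable.integral_prod_right'.aestronglyMeasurable
  · filter_upwards [schrodinger_ae_eq_fourierInv hS hS' hf t] with x hx
    exact hx.symm

end SpectralDensity

/-- The bilinear estimate for free waves with spectra in a disc of radius `ρ` and outside a disc of
radius `l`. -/
theorem eLpNorm_mul_freeEvolution_le {f g : PlaneL2} {S S' : Set Plane} (hS : MeasurableSet S)
    (hS' : MeasurableSet S') (hSf : volume S ≠ ⊤) (hSf' : volume S' ≠ ⊤)
    (hf : ∀ᵐ η : Plane, η ∉ S → (𝓕 f : PlaneL2) η = 0)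
    (hg : ∀ᵐ η : Plane, η ∉ S' → (𝓕 g : PlaneL2) η = 0)
    {ρ l : ℝ} (hρ : 0 < ρ) (hl : 0 < l) (hSρ : ∀ η ∈ S, ‖η‖ ≤ ρ) (hSl : ∀ η ∈ S', l ≤ ‖η‖)
    {u v : ℝ × Plane → ℂ} (hu : IsFreeEvolution f u) (hv : IsFreeEvolution g v) :
    eLpNorm (fun z => u z * v z) 2 volume ≤
      ENNReal.ofReal (√(3 * (ρ / l)) * ‖f‖ * ‖g‖) := by
  rw [← ENNReal.pow_le_pow_left_iff two_ne_zero, eLpNorm_two_sq, Measure.volume_eq_prod,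
    lintegral_prod _ (by
      rw [← Measure.volume_eq_prod]
      exact ((hu.aestronglyMeasurable.mul hv.aestronglyMeasurable).enorm).pow_const 2)]
  have h : ∀ t : ℝ, ∫⁻ x : Plane, ‖u (t, x) * v (t, x)‖ₑ ^ 2 = ∫⁻ x : Plane,
      ‖𝓕⁻ (fun η => schrodingerSymbol t η * spectralDensity S f η) x *
        𝓕⁻ (fun η => schrodingerSymbol t η * spectralDensity S' g η) x‖ₑ ^ 2 := fun t => by
    apply lintegral_congr_ae
    filter_upwards [hu.ae_eq t, hv.ae_eq t, schrodinger_ae_eq_fourierInv hS hSf hf t,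
      schrodinger_ae_eq_fourierInv hS' hSf' hg t] with x h1 h2 h3 h4
    rw [h1, h2, h3, h4]
  simp_rw [h]
  refine (lintegral_fourierInv_mul_fourierInv_le (measurable_spectralDensity hS)
    (measurable_spectralDensity hS') (integrable_spectralDensity hS hSf)
    (integrable_spectralDensity hS' hSf') (memLp_spectralDensity hS) (memLp_spectralDensity hS')
    hρ hl (fun η hη => hSρ η (Set.mem_of_indicator_ne_zero hη))
    (fun η hη => hSl η (Set.mem_of_indicator_ne_zero hη))).trans ?_
  have hC : (0 : ℝ) ≤ 3 * (ρ / l) := by positivity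
  calc _ ≤ ENNReal.ofReal (3 * (ρ / l)) *
        (ENNReal.ofReal (‖f‖ ^ 2) * ENNReal.ofReal (‖g‖ ^ 2)) := by
        gcongr <;> exact lintegral_enorm_spectralDensity_sq_le _ _
    _ = _ := by
        rw [← ENNReal.ofReal_mul (by positivity), ← ENNReal.ofReal_mul (by positivity),
          ← ENNReal.ofReal_pow (by positivity), mul_pow, mul_pow, Real.sq_sqrt hC, mul_assoc (3 * (ρ / l))]

/-! ### Littlewood–Paley supports and the conclusion -/

theorem IsLPBump.exists_radius {φ : Plane → ℂ} (hφ : IsLPBump φ) :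
    ∃ R : ℝ, 0 < R ∧ ∀ ξ : Plane, R < ‖ξ‖ → φ ξ = 0 := by
  obtain ⟨R, hR, h⟩ := hφ.hasCompactSupport.isCompact.isBounded.exists_pos_norm_le
  refine ⟨R, hR, fun ξ hξ => ?_⟩
  by_contra h0
  exact absurd (h ξ (subset_tsupport _ h0)) (not_le.2 hξ)

/-- The frequency support of an `L²` function in the range of a Littlewood–Paley projection. -/
theorem fourier_ae_eq_zero_of_lpProj_eq {φ : Plane → ℂ} (hφ : IsLPBump φ) {R : ℝ}
    (hR : ∀ ξ : Plane, R < ‖ξ‖ → φ ξ = 0) {j : ℤ} {T : 𝓢'(Plane, ℂ)} {f : PlaneL2}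
    (h : lpProj φ j T = (f : 𝓢'(Plane, ℂ))) :
    ∀ᵐ η : Plane, η ∉ {η : Plane | (2 : ℝ) ^ j / (2 * Real.pi) ≤ ‖η‖ ∧
      ‖η‖ ≤ 2 * R * (2 : ℝ) ^ j / (2 * Real.pi)} → (𝓕 f : PlaneL2) η = 0 := by
  have hpi := Real.pi_pos
  have h2j : (0 : ℝ) < 2 ^ j := by positivity
  have hφt : φ.HasTemperateGrowth := hφ.hasCompactSupport.hasTemperateGrowth hφ.contDiff
  have hm : Function.HasTemperateGrowth
      fun η : Plane => lpCutoff φ ((2 : ℝ) ^ (-j) • (2 * Real.pi) • η) := by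
    have hs : ∀ c : ℝ, (fun η : Plane => φ (c • η)).HasTemperateGrowth := fun c =>
      hφt.comp ((c • ContinuousLinearMap.id ℝ Plane).hasTemperateGrowth)
    simp only [lpCutoff, smul_smul]
    exact (hs _).sub (hs _)
  have hnorm : ∀ η : Plane, ‖(2 : ℝ) ^ (-j) • (2 * Real.pi) • η‖ =
      2 * Real.pi * ‖η‖ / 2 ^ j := fun η => by
    rw [norm_smul, norm_smul, Real.norm_of_nonneg (by positivity),
      Real.norm_of_nonneg (by positivity), zpow_neg]
    field_simp
  have hhalf : ∀ ξ : Plane, ‖(2 : ℝ)⁻¹ • ξ‖ = ‖ξ‖ / 2 := fun ξ => by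
    rw [norm_smul, Real.norm_of_nonneg (by norm_num)]
    ring
  -- Here `ξ` and `ξ/2` both lie in the unit disc, where `φ = 1`, so the two terms cancel.
  have hin := fourier_ae_eq_zero_of_fourierMultiplier_eq hm h
    (U := {η : Plane | ‖η‖ < (2 : ℝ) ^ j / (2 * Real.pi)})
    (isOpen_lt continuous_norm continuous_const) fun η hη => by
      have hη : ‖η‖ < (2 : ℝ) ^ j / (2 * Real.pi) := hη
      rw [lt_div_iff₀ (by positivity)] at hη
      have h1 : 2 * Real.pi * ‖η‖ / 2 ^ j ≤ 1 := by
        rw [div_le_one h2j]; linarith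
      simp only [lpCutoff]
      rw [hφ.eq_one _ (by rw [hhalf, hnorm]; linarith),
        hφ.eq_one _ (by rw [hnorm]; exact h1), sub_self]
  -- The outer radius is `2R` rather than `R` because of the term `φ(ξ/2)`.
  have hout := fourier_ae_eq_zero_of_fourierMultiplier_eq hm h
    (U := {η : Plane | 2 * R * (2 : ℝ) ^ j / (2 * Real.pi) < ‖η‖})
    (isOpen_lt continuous_const continuous_norm) fun η hη => by
      have hη : 2 * R * (2 : ℝ) ^ j / (2 * Real.pi) < ‖η‖ := hη
      rw [div_lt_iff₀ (by positivity)] at hη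
      have h0 : 0 ≤ 2 * Real.pi * ‖η‖ / 2 ^ j := by positivity
      have h1 : 2 * R < 2 * Real.pi * ‖η‖ / 2 ^ j := by
        rw [lt_div_iff₀ h2j]; linarith
      simp only [lpCutoff]
      rw [hR _ (by rw [hhalf, hnorm]; linarith), hR _ (by rw [hnorm]; linarith), sub_self]
  filter_upwards [hin, hout] with η h1 h2 hη
  by_cases h3 : ‖η‖ < (2 : ℝ) ^ j / (2 * Real.pi)
  · exact h1 h3
  · refine h2 (show _ < _ from ?_)
    by_contra h4
    exact hη ⟨not_lt.1 h3, not_lt.1 h4⟩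

theorem theorem3p1 (φ : Plane → ℂ) (hφ : IsLPBump φ) :
    ∃ C : ℝ, 0 < C ∧
      ∀ j k : ℤ, j ≤ k - 10 →
      ∀ u₀ v₀ : 𝓢'(Plane, ℂ), ∀ f g : PlaneL2,
        lpProj φ j u₀ = (f : 𝓢'(Plane, ℂ)) → lpProj φ k v₀ = (g : 𝓢'(Plane, ℂ)) →
        (∃ u : ℝ × Plane → ℂ, IsFreeEvolution f u) ∧
        (∃ v : ℝ × Plane → ℂ, IsFreeEvolution g v) ∧
        ∀ u v : ℝ × Plane → ℂ, IsFreeEvolution f u → IsFreeEvolution g v →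
          eLpNorm (fun z => u z * v z) 2 volume ≤
            ENNReal.ofReal (C * (2 : ℝ) ^ (((j : ℝ) - (k : ℝ)) / 2) * ‖f‖ * ‖g‖) := by
  obtain ⟨R, hR, hφR⟩ := hφ.exists_radius
  have hpi := Real.pi_pos
  -- The squared constant is `3ρ/l` with `ρ/l = 2R · 2 ^ (j - k)`; the factors `2π` cancel in the
  -- quotient.
  refine ⟨√(6 * R), by positivity, fun j k _ u₀ v₀ f g hf hg => ?_⟩
  have hmeas : ∀ a b : ℝ, MeasurableSet {η : Plane | a ≤ ‖η‖ ∧ ‖η‖ ≤ b} := fun a b =>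
    (measurableSet_le measurable_const measurable_norm).inter
      (measurableSet_le measurable_norm measurable_const)
  have hfin : ∀ a b : ℝ, volume {η : Plane | a ≤ ‖η‖ ∧ ‖η‖ ≤ b} ≠ ⊤ := fun a b =>
    ne_top_of_le_ne_top (measure_closedBall_lt_top (x := (0 : Plane)) (r := b)).ne
      (measure_mono fun η hη => by simpa using hη.2)
  have hf' := fourier_ae_eq_zero_of_lpProj_eq hφ hφR hf
  have hg' := fourier_ae_eq_zero_of_lpProj_eq hφ hφR hg
  refine ⟨exists_isFreeEvolution (hmeas _ _) (hfin _ _) hf',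
    exists_isFreeEvolution (hmeas _ _) (hfin _ _) hg', fun u v hu hv => ?_⟩
  refine (eLpNorm_mul_freeEvolution_le (hmeas _ _) (hmeas _ _) (hfin _ _) (hfin _ _) hf' hg'
    (ρ := 2 * R * (2 : ℝ) ^ j / (2 * Real.pi)) (l := (2 : ℝ) ^ k / (2 * Real.pi))
    (by positivity) (by positivity) (fun η hη => hη.2) (fun η hη => hη.1) hu hv).trans_eq ?_
  have h1 : 3 * (2 * R * (2 : ℝ) ^ j / (2 * Real.pi) / ((2 : ℝ) ^ k / (2 * Real.pi))) =
      6 * R * (2 : ℝ) ^ ((j : ℝ) - (k : ℝ)) := by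
    rw [Real.rpow_sub two_pos, Real.rpow_intCast, Real.rpow_intCast]
    field_simp
    norm_num
  rw [h1, Real.sqrt_mul (by positivity), Real.sqrt_eq_rpow (2 ^ _), ← Real.rpow_mul zero_le_two,
    mul_one_div]
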